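/- Let $\Sigma$ be a complete simplicial fan in $\mathbb R^n$ with primitive ray generators $\mathbf v_1,\dots,\mathbf v_r\in\mathbb Z^n$, let $\phi:\mathbb Z^n\to\mathbb Z^r$, $\phi(\mathbf m)=(\langle \mathbf m,\mathbf v_1\rangle,\dots,\langle \mathbf m,\mathbf v_r\rangle)$, let $L_\beta=\phi(\mathbb Z^n)$, and assume that the class group $\mathbb Z^r/L_\beta$ is free. Let $\mathbb F_q$ be a finite field with $q$ elements, $\mathbb K$ an extension field of $\mathbb F_q$ and $\overline{\mathbb K}$ an algebraic closure of $\mathbb K$. Grade polynomial rings in $x_1,\dots,x_r$ by letting $\deg x_i$ be the class of the $i$-th standard basis vector in $\mathbb Z^r/L_\beta$; "homogeneous" refers to this grading. Let $G=\{P\in(\overline{\mathbb K}^*)^r : \prod_i p_i^{m_i}=1 \text{ for all } \mathbf m\in L_\beta\}$, let $B$ be the ideal generated by the monomials $\prod_{\mathbf v_i\notin\sigma}x_i$, $\sigma\in\Sigma$, let $X=(\overline{\mathbb K}^r\setminus V(B))/G$ be the toric variety of $\Sigma$, and let $T_X=(\overline{\mathbb K}^*)^r/G\subseteq X$ be its torus.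 For a field $k\in\{\mathbb F_q,\mathbb K\}$ let $X(k)$ (resp. $T_X(k)$) be the set of orbits $[P]=G\cdot P$ with $P\in k^r\setminus V(B)$ (resp. $P\in(k^*)^r$). For an ideal $J$ let $V_{X(k)}(J)$ be the set of $[P]\in X(k)$ at which all homogeneous elements of $J$ vanish, and for $Y\subseteq X$ let $I(Y)$ be the ideal generated by the homogeneous polynomials vanishing on $Y$. For a subgroup $L\subseteq\mathbb Z^r$ let $I_L=\langle \mathbf x^{\mathbf m^+}-\mathbf x^{\mathbf m^-} : \mathbf m\in L\rangle$. If $(q-1)L_\beta\subseteq L\subseteq L_\beta$, then $$I(V_{X(\mathbb K)}(I_L))=I_L ,$$ where both ideals are taken in $\mathbb F_q[x_1,\dots,x_r]$ or both in $\mathbb K[x_1,\dots,x_r]$; moreover, $V_{X(\mathbb K)}(I_L)=V_{X(\mathbb F_q)}(I_L)$, where $I_L$ on the left-hand side may be taken over $\mathbb F_q$ or over $\mathbb K$. Furthermore, $J\mapsto V_{X(\mathbb F_q)}(J)$ is a bijection from the set of lattice ideals $I_L\subseteq\mathbb F_q[x_1,\dots,x_r]$ with $(q-1)L_\beta\subseteq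 L\subseteq L_\beta$ onto the set of subgroups of $T_X(\mathbb F_q)$, with inverse $Y\mapsto I(Y)$. -/

import Mathlib

/-- A complete simplicial (rational, polyhedral) fan in `ℝⁿ` whose rays are generated by the
primitive lattice vectors `ray 0, …, ray (r - 1) ∈ ℤⁿ`. Since every cone is simplicial, it is
recorded by the set of indices of its generating rays; the faces of the cone spanned by `σ` are
the cones spanned by the subsets of `σ`. -/
structure CompleteSimplicialFan (n r : ℕ) where
  /-- the ray generators `v₁, …, v_r` -/
  ray : Fin r → Fin n → ℤ
  /-- the cones of the fan, as sets of ray indices -/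
  cones : Finset (Finset (Fin r))
  /-- the generators are primitive lattice vectors -/
  primitive : ∀ (i : Fin r) (k : ℤ) (w : Fin n → ℤ), ray i = k • w → IsUnit k
  /-- every ray is a cone of the fan -/
  ray_mem : ∀ i : Fin r, {i} ∈ cones
  /-- every cone is simplicial -/
  simplicial : ∀ σ ∈ cones,
    LinearIndependent ℝ (fun i : σ => (fun j => (ray i j : ℝ) : Fin n → ℝ))
  /-- faces of cones of the fan are cones of the fan -/
  face_mem : ∀ σ ∈ cones, ∀ τ ⊆ σ, τ ∈ cones
  /-- two cones of the fan intersect in their common face -/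
  inter : ∀ σ ∈ cones, ∀ τ ∈ cones,
    PointedCone.hull ℝ ((fun i j => (ray i j : ℝ)) '' (σ : Set (Fin r))) ⊓
      PointedCone.hull ℝ ((fun i j => (ray i j : ℝ)) '' (τ : Set (Fin r))) =
    PointedCone.hull ℝ ((fun i j => (ray i j : ℝ)) '' ((σ ∩ τ : Finset (Fin r)) : Set (Fin r)))
  /-- the cones cover `ℝⁿ` -/
  complete : ∀ x : Fin n → ℝ, ∃ σ ∈ cones,
    x ∈ PointedCone.hull ℝ ((fun i j => (ray i j : ℝ)) '' (σ : Set (Fin r)))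

namespace CompleteSimplicialFan

variable {n r : ℕ} (Δ : CompleteSimplicialFan n r)

/-- The injection `φ : ℤⁿ → ℤʳ`, `m ↦ (⟨m, v₁⟩, …, ⟨m, v_r⟩)`. -/
def phi : (Fin n → ℤ) →ₗ[ℤ] (Fin r → ℤ) :=
  Matrix.mulVecLin (Matrix.of Δ.ray)

/-- The lattice `L_β ⊆ ℤʳ`: the image of `φ`, spanned by the columns of the matrix of `φ`. -/
def latticeBeta : Submodule ℤ (Fin r → ℤ) :=
  LinearMap.range Δ.phi

/-- The class group `Cl X = ℤʳ / L_β`. -/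
abbrev ClGroup : Type :=
  (Fin r → ℤ) ⧸ Δ.latticeBeta

/-- The degree `β_i ∈ Cl X` of the variable `x_i`. -/
noncomputable def degVar (i : Fin r) : Δ.ClGroup :=
  Δ.latticeBeta.mkQ (Pi.single i 1)

/-- A polynomial of the Cox ring is homogeneous if all its monomials have the same degree in
`Cl X`. -/
def IsHomog {R : Type*} [CommSemiring R] (f : MvPolynomial (Fin r) R) : Prop :=
  ∃ α : Δ.ClGroup, f.IsWeightedHomogeneous Δ.degVar α

/-- The irrelevant ideal `B`, generated by the monomials `∏_{i ∉ σ} x_i` for the cones `σ`. -/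
noncomputable def irrelevantIdeal (R : Type*) [CommRing R] : Ideal (MvPolynomial (Fin r) R) :=
  Ideal.span {f | ∃ σ ∈ Δ.cones, f = ∏ i ∈ σᶜ, MvPolynomial.X i}

section Points

variable (Ω : Type*) [Field Ω]

/-- The homomorphism `π : (Ω*)ʳ → (Ω*)ⁿ`, `P ↦ (x^{u₁}(P), …, x^{u_n}(P))`, where `u_j` is the
`j`-th column of the matrix of `φ`. -/
noncomputable def torusPi : (Fin r → Ωˣ) →* (Fin n → Ωˣ) where
  toFun P j := ∏ i, P i ^ Δ.ray i j
  map_one' := by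
    funext j
    simp
  map_mul' P Q := by
    funext j
    simp [mul_zpow, Finset.prod_mul_distrib]

/-- The group `G = ker π ⊆ (Ω*)ʳ`. -/
noncomputable def groupG : Subgroup (Fin r → Ωˣ) :=
  (Δ.torusPi Ω).ker

/-- The set `Ωʳ \ V(B)`, with the coordinatewise action of `G`. -/
noncomputable def stablePoints : SubMulAction (Δ.groupG Ω) (Fin r → Ω) where
  carrier := {P | P ∉ MvPolynomial.zeroLocus Ω (Δ.irrelevantIdeal Ω)}
  smul_mem' g P hP := by
    intro h
    refine hP ?_
    rw [irrelevantIdeal, MvPolynomial.zeroLocus_span] at h ⊢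
    rintro f ⟨σ, hσ, rfl⟩
    have h1 := h _ ⟨σ, hσ, rfl⟩
    rw [map_prod, Finset.prod_eq_zero_iff] at h1 ⊢
    obtain ⟨i, hi, h2⟩ := h1
    refine ⟨i, hi, ?_⟩
    rw [MvPolynomial.aeval_X] at h2 ⊢
    have h3 : ((g : Fin r → Ωˣ) i : Ω) * P i = 0 := h2
    exact (mul_eq_zero.mp h3).resolve_left (Units.ne_zero _)

/-- The points of the toric variety `X` over the algebraically closed field `Ω`: the quotient
`(Ωʳ \ V(B)) / G`. -/
abbrev Points : Type _ :=
  MulAction.orbitRel.Quotient (Δ.groupG Ω) (Δ.stablePoints Ω)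

/-- The torus `T_X = (Ω*)ʳ / G`. -/
abbrev Torus : Type _ :=
  (Fin r → Ωˣ) ⧸ Δ.groupG Ω

/-- Points of `(Ω*)ʳ` do not lie in `V(B)`. -/
theorem coe_mem_stablePoints (P : Fin r → Ωˣ) :
    (fun i => (P i : Ω)) ∈ Δ.stablePoints Ω := by
  intro h
  obtain ⟨σ, hσ, -⟩ := Δ.complete 0
  rw [irrelevantIdeal, MvPolynomial.zeroLocus_span] at h
  have h1 := h _ ⟨σ, hσ, rfl⟩
  rw [map_prod, Finset.prod_eq_zero_iff] at h1
  obtain ⟨i, -, h2⟩ := h1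
  rw [MvPolynomial.aeval_X] at h2
  exact (P i).ne_zero h2

/-- The inclusion `T_X ⊆ X`, `G · P ↦ G · P`. -/
noncomputable def torusInclusion : Δ.Torus Ω → Δ.Points Ω :=
  Quotient.lift (fun P => Quotient.mk'' ⟨fun i => (P i : Ω), Δ.coe_mem_stablePoints Ω P⟩) (by
    intro P Q h
    have h1 : P⁻¹ * Q ∈ Δ.groupG Ω := QuotientGroup.leftRel_apply.mp h
    refine Quotient.sound' ?_
    refine MulAction.orbitRel_apply.mpr ⟨⟨(P⁻¹ * Q)⁻¹, inv_mem h1⟩, ?_⟩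
    refine Subtype.ext (funext fun i => ?_)
    change (((P⁻¹ * Q)⁻¹ i : Ωˣ) : Ω) * (Q i : Ω) = (P i : Ω)
    rw [← Units.val_mul]
    congr 1
    simp)

/-- The subgroup `T_X(k)` of `T_X`: the points with representatives in `(k*)ʳ`. -/
noncomputable def torusRational (k : Type*) [Field k] [Algebra k Ω] : Subgroup (Δ.Torus Ω) :=
  ((MonoidHom.compLeft (Units.map (algebraMap k Ω : k →* Ω)) (Fin r)).range).map
    (QuotientGroup.mk' (Δ.groupG Ω))

/-- The set `X(k)` of `k`-rational points of `X`: the orbits `[P] = G · P` of the points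
`P ∈ kʳ \ V(B)`. -/
def rationalPoints (k : Type*) [Field k] [Algebra k Ω] : Set (Δ.Points Ω) :=
  {x | ∃ (P : Fin r → k) (hP : (fun i => algebraMap k Ω (P i)) ∈ Δ.stablePoints Ω),
    x = Quotient.mk'' ⟨fun i => algebraMap k Ω (P i), hP⟩}

variable {Ω}

/-- The polynomial `f` vanishes at the representatives of the point `x` of `X`. (For homogeneous
`f` this does not depend on the representative.) -/
def VanishesAt {R : Type*} [CommRing R] [Algebra R Ω] (f : MvPolynomial (Fin r) R)
    (x : Δ.Points Ω) : Prop :=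
  ∀ P : Δ.stablePoints Ω, (Quotient.mk'' P : Δ.Points Ω) = x →
    MvPolynomial.aeval (P : Fin r → Ω) f = 0

variable (Ω)

/-- `V_{X(k)}(J)`: the `k`-rational points of `X` at which every homogeneous element of `J`
vanishes. -/
noncomputable def zeroSet (k : Type*) [Field k] [Algebra k Ω] {R : Type*} [CommRing R] [Algebra R Ω]
    (J : Ideal (MvPolynomial (Fin r) R)) : Set (Δ.Points Ω) :=
  {x | x ∈ Δ.rationalPoints Ω k ∧ ∀ f ∈ J, Δ.IsHomog f → Δ.VanishesAt f x}

variable {Ω}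

/-- `I(Y)`: the ideal of the Cox ring `R[x₁, …, x_r]` generated by the homogeneous polynomials
that vanish on `Y ⊆ X`. -/
noncomputable def idealOf (R : Type*) [CommRing R] [Algebra R Ω] (Y : Set (Δ.Points Ω)) :
    Ideal (MvPolynomial (Fin r) R) :=
  Ideal.span {f | Δ.IsHomog f ∧ ∀ x ∈ Y, Δ.VanishesAt f x}

end Points

end CompleteSimplicialFan

/-- The lattice ideal `I_L = ⟨x^{m⁺} - x^{m⁻} : m ∈ L⟩` in `R[x₁, …, x_r]`. -/
noncomputable def latticeIdeal (R : Type*) [CommRing R] {r : ℕ} (L : Submodule ℤ (Fin r → ℤ)) :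
    Ideal (MvPolynomial (Fin r) R) :=
  Ideal.span {f | ∃ m ∈ L, f =
    MvPolynomial.monomial (Finsupp.equivFunOnFinite.symm fun i => (m i).toNat) 1 -
    MvPolynomial.monomial (Finsupp.equivFunOnFinite.symm fun i => (-m i).toNat) 1}

/-- The condition `(q - 1) L_β ⊆ L ⊆ L_β` on a lattice `L ⊆ ℤʳ`. -/
def CompleteSimplicialFan.IsIntermediate {n r : ℕ} (Δ : CompleteSimplicialFan n r) (q : ℕ)
    (L : Submodule ℤ (Fin r → ℤ)) : Prop :=
  (∀ m ∈ Δ.latticeBeta, ((q : ℤ) - 1) • m ∈ L) ∧ L ≤ Δ.latticeBeta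

/-! Completeness makes `φ` injective, and freeness of the class group splits it: there is `ψ` with
`ψ ∘ φ = id`. Dually, `π : (Ω*)ʳ → (Ω*)ⁿ` has kernel `G` and a monomial section given by `ψ`, so the
torus over `F` is `(F*)ⁿ` and its characters are `φ(u)`, `u ∈ ℤⁿ`.

Three facts carry the proof. Duality: since `F*` is cyclic of order `q - 1`, lattices between `(q -
1) L_β` and `L_β` correspond to subgroups of `(F*)ⁿ` by taking annihilators
(`latticeSubgroup_subgroupLattice`, `subgroupLattice_latticeSubgroup`). Zero sets: the binomials of
`I_L` force a point into the torus, and there cut out exactly the annihilator of `L`, over any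
intermediate field (`zeroSet_latticeIdeal`). Ideals: a homogeneous polynomial restricted to a
subgroup `H` is a linear combination of characters of `H`; by Dedekind independence it vanishes only
if it lies in the lattice ideal of the annihilator of `H` (`mem_latticeIdeal_of_vanishes`,
`idealOf_subgroupPoints`). -/

/-- The Laurent monomial `P ^ m = ∏ i, P i ^ m i` as a homomorphism in the exponent `m`. -/
def laurentMonomial {ι A : Type*} [Fintype ι] [CommGroup A] (P : ι → A) :
    Multiplicative (ι → ℤ) →* A where
  toFun m := ∏ i, P i ^ m.toAdd i
  map_one' := by simp
  map_mul' m m' := by simp [zpow_add, Finset.prod_mul_distrib]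

/-! ### Laurent monomials and monomial maps of tori -/

section LaurentMonomial

variable {ι κ A : Type*} [Fintype ι] [CommGroup A]

/-- The Laurent monomial `∏ i, P i ^ m i`. -/
def zmon (P : ι → A) (m : ι → ℤ) : A := laurentMonomial P (Multiplicative.ofAdd m)

theorem zmon_eq_prod (P : ι → A) (m : ι → ℤ) : zmon P m = ∏ i, P i ^ m i := rfl

@[simp] theorem zmon_zero (P : ι → A) : zmon P 0 = 1 := map_one (laurentMonomial P)

theorem zmon_add (P : ι → A) (m m' : ι → ℤ) : zmon P (m + m') = zmon P m * zmon P m' :=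
  map_mul (laurentMonomial P) _ _

theorem zmon_sub (P : ι → A) (m m' : ι → ℤ) : zmon P (m - m') = zmon P m / zmon P m' :=
  map_div (laurentMonomial P) _ _

theorem zmon_zsmul (P : ι → A) (k : ℤ) (m : ι → ℤ) : zmon P (k • m) = zmon P m ^ k :=
  map_zpow (laurentMonomial P) (Multiplicative.ofAdd m) k

theorem zmon_sum {γ : Type*} (P : ι → A) (s : Finset γ) (f : γ → ι → ℤ) :
    zmon P (∑ c ∈ s, f c) = ∏ c ∈ s, zmon P (f c) := by
  classical
  induction s using Finset.induction_on with
  | empty => simp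
  | insert a s ha ih => rw [Finset.sum_insert ha, Finset.prod_insert ha, zmon_add, ih]

@[simp] theorem zmon_one_left (m : ι → ℤ) : zmon (1 : ι → A) m = 1 := by simp [zmon_eq_prod]

theorem zmon_mul_left (P Q : ι → A) (m : ι → ℤ) : zmon (P * Q) m = zmon P m * zmon Q m := by
  simp [zmon_eq_prod, mul_zpow, Finset.prod_mul_distrib]

theorem map_zmon {B : Type*} [CommGroup B] (f : A →* B) (P : ι → A) (m : ι → ℤ) :
    f (zmon P m) = zmon (fun i => f (P i)) m := by
  simp [zmon_eq_prod, map_prod, map_zpow]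

theorem zmon_single [DecidableEq ι] (P : ι → A) (i : ι) : zmon P (Pi.single i 1) = P i := by
  rw [zmon_eq_prod, Finset.prod_eq_single i]
  · simp
  · intro j _ h
    simp [h]
  · simp

/-- The Laurent monomial as a homomorphism on points. -/
def zmonHom (m : ι → ℤ) : (ι → A) →* A where
  toFun P := zmon P m
  map_one' := zmon_one_left m
  map_mul' P Q := zmon_mul_left P Q m

@[simp] theorem zmonHom_apply (m : ι → ℤ) (P : ι → A) : zmonHom m P = zmon P m := rfl

/-- The monomial map of tori dual to a homomorphism of character lattices. -/
def monomialMap [DecidableEq κ] (ψ : (κ → ℤ) →ₗ[ℤ] (ι → ℤ)) : (ι → A) →* (κ → A) where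
  toFun t k := zmon t (ψ (Pi.single k 1))
  map_one' := by ext; simp
  map_mul' t t' := by ext; simp [zmon_mul_left]

theorem zmon_monomialMap [Fintype κ] [DecidableEq κ] (ψ : (κ → ℤ) →ₗ[ℤ] (ι → ℤ)) (t : ι → A)
    (m : κ → ℤ) :
    zmon (monomialMap ψ t) m = zmon t (ψ m) := by
  conv_rhs => rw [← Finset.univ_sum_single m, map_sum, zmon_sum]
  rw [zmon_eq_prod]
  refine Finset.prod_congr rfl fun k _ => ?_
  have : (Pi.single k (m k) : κ → ℤ) = m k • Pi.single k 1 := by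
    rw [← Pi.single_smul]
    simp
  rw [this, map_smul, zmon_zsmul]
  rfl

theorem map_monomialMap [DecidableEq κ] {B : Type*} [CommGroup B] (f : A →* B)
    (ψ : (κ → ℤ) →ₗ[ℤ] (ι → ℤ)) (t : ι → A) (k : κ) :
    f (monomialMap ψ t k) = monomialMap ψ (fun i => f (t i)) k :=
  map_zmon f t _

/-- An endomorphism of a cyclic group is a power map; apply this to `χ` on each coordinate factor.
-/
theorem exists_zmon_eq_of_isCyclic [IsCyclic A] (χ : (ι → A) →* A) :
    ∃ u : ι → ℤ, ∀ t, χ t = zmon t u := by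
  classical
  have h : ∀ i, ∃ k : ℤ, ∀ a, χ (Pi.mulSingle i a) = a ^ k := fun i => by
    obtain ⟨k, hk⟩ := MonoidHom.map_cyclic (χ.comp (MonoidHom.mulSingle (fun _ => A) i))
    exact ⟨k, hk⟩
  choose u hu using h
  refine ⟨u, fun t => ?_⟩
  conv_lhs => rw [← Finset.univ_prod_mulSingle t, map_prod]
  simp [hu, zmon_eq_prod]

end LaurentMonomial

/-! ### Character duality over a finite field -/

section FiniteField

variable (F : Type*) [Field F] [Fintype F]

theorem hasEnoughRootsOfUnity_card_sub_one : HasEnoughRootsOfUnity F (Fintype.card F - 1) where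
  prim := by
    classical
    obtain ⟨g, hg⟩ := IsCyclic.exists_generator (α := Fˣ)
    refine ⟨(g : F), IsPrimitiveRoot.coe_units_iff.mpr ?_⟩
    rw [← Fintype.card_units, ← Nat.card_eq_fintype_card,
      ← orderOf_eq_card_of_forall_mem_zpowers hg]
    exact IsPrimitiveRoot.orderOf g
  cyc := inferInstance

variable {F}

theorem units_pow_card_sub_one (a : Fˣ) : a ^ (Fintype.card F - 1) = 1 := by
  ext
  simpa using FiniteField.pow_card_sub_one_eq_one (a : F) a.ne_zero

theorem zpow_card_sub_one (a : Fˣ) : a ^ ((Fintype.card F : ℤ) - 1) = 1 := by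
  have h := units_pow_card_sub_one a
  rw [← zpow_natCast, Nat.cast_sub Fintype.card_pos] at h
  simpa using h

/-- The polynomial `X ^ (q - 1) - 1` has at most `q - 1` roots in `Ω`, and the units of `F` already
provide that many. -/
theorem exists_units_map_eq {Ω : Type*} [Field Ω] [Algebra F Ω] (x : Ωˣ)
    (hx : x ^ ((Fintype.card F : ℤ) - 1) = 1) :
    ∃ a : Fˣ, Units.map (algebraMap F Ω : F →* Ω) a = x := by
  classical
  have hq : 0 < Fintype.card F - 1 := Nat.sub_pos_of_lt Fintype.one_lt_card
  have hinj : Function.Injective (fun a : Fˣ => algebraMap F Ω a) :=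
    (algebraMap F Ω).injective.comp Units.val_injective
  have hsub : Finset.univ.image (fun a : Fˣ => algebraMap F Ω a) ⊆
      Polynomial.nthRootsFinset (Fintype.card F - 1) (1 : Ω) := by
    intro y hy
    obtain ⟨a, -, rfl⟩ := Finset.mem_image.mp hy
    rw [Polynomial.mem_nthRootsFinset hq, ← map_pow,
      FiniteField.pow_card_sub_one_eq_one _ a.ne_zero, map_one]
  have heq := Finset.eq_of_subset_of_card_le hsub (by
    rw [Finset.card_image_of_injective _ hinj, Finset.card_univ, Fintype.card_units]
    refine (Multiset.toFinset_card_le _).trans ?_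
    exact Polynomial.card_nthRoots _ _)
  have hx' : x ^ (Fintype.card F - 1) = 1 := by
    rw [← zpow_natCast, Nat.cast_sub Fintype.card_pos]
    simpa using hx
  have hmem : (x : Ω) ∈ Polynomial.nthRootsFinset (Fintype.card F - 1) (1 : Ω) := by
    rw [Polynomial.mem_nthRootsFinset hq]
    rw [← Units.val_pow_eq_pow_val, hx', Units.val_one]
  rw [← heq] at hmem
  obtain ⟨a, -, ha⟩ := Finset.mem_image.mp hmem
  exact ⟨a, Units.ext ha⟩

variable {ι : Type*} [Fintype ι]

/-- The quotient by `M` is finitely generated and killed by `q - 1`, hence finite, and its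
characters with values in `F*` separate points. Such a character, pulled back to `ι → ℤ`, is
evaluation at the point formed by its values on the standard basis. -/
theorem exists_zmon_ne_one_of_notMem_submodule (M : Submodule ℤ (ι → ℤ))
    (hM : ∀ u, ((Fintype.card F : ℤ) - 1) • u ∈ M) {m : ι → ℤ} (hm : m ∉ M) :
    ∃ t : ι → Fˣ, (∀ l ∈ M, zmon t l = 1) ∧ zmon t m ≠ 1 := by
  classical
  have hq : Fintype.card F - 1 ≠ 0 := (Nat.sub_pos_of_lt Fintype.one_lt_card).ne'
  have hcast : ((Fintype.card F - 1 : ℕ) : ℤ) = (Fintype.card F : ℤ) - 1 := by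
    rw [Nat.cast_sub Fintype.card_pos, Nat.cast_one]
  have htor : ∀ x : (ι → ℤ) ⧸ M, (Fintype.card F - 1) • x = 0 := fun x => by
    obtain ⟨u, rfl⟩ := M.mkQ_surjective x
    rw [← natCast_zsmul, hcast, ← map_zsmul]
    exact (Submodule.Quotient.mk_eq_zero M).mpr (hM u)
  have : Finite ((ι → ℤ) ⧸ M) := by
    refine Module.finite_of_fg_torsion _ fun {x} => ?_
    refine ⟨⟨((Fintype.card F - 1 : ℕ) : ℤ), ?_⟩, ?_⟩
    · exact mem_nonZeroDivisors_of_ne_zero (by exact_mod_cast hq)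
    · rw [Submonoid.mk_smul, natCast_zsmul]
      exact htor x
  have : NeZero (Fintype.card F - 1) := ⟨hq⟩
  have := hasEnoughRootsOfUnity_card_sub_one F
  have : HasEnoughRootsOfUnity F (Monoid.exponent (Multiplicative ((ι → ℤ) ⧸ M))) :=
    HasEnoughRootsOfUnity.of_dvd F (n := Fintype.card F - 1)
      (Monoid.exponent_dvd_of_forall_pow_eq_one fun x => htor x.toAdd)
  have hne : Multiplicative.ofAdd (M.mkQ m) ≠ 1 := fun h =>
    hm ((Submodule.Quotient.mk_eq_zero M).mp (Multiplicative.ofAdd.injective h))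
  obtain ⟨χ, hχ⟩ := CommGroup.exists_apply_ne_one_of_hasEnoughRootsOfUnity _ F hne
  have key : ∀ l, zmon (fun i => χ (.ofAdd (M.mkQ (Pi.single i 1)))) l = χ (.ofAdd (M.mkQ l)) := by
    intro l
    conv_rhs => rw [← Finset.univ_sum_single l, map_sum, ofAdd_sum, map_prod]
    rw [zmon_eq_prod]
    refine Finset.prod_congr rfl fun k _ => ?_
    have : (Pi.single k (l k) : ι → ℤ) = l k • Pi.single k 1 := by
      rw [← Pi.single_smul]
      simp
    rw [this, map_smul, ofAdd_zsmul, map_zpow]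
  refine ⟨fun i => χ (.ofAdd (M.mkQ (Pi.single i 1))), fun l hl => ?_, ?_⟩
  · rw [key, show M.mkQ l = 0 from (Submodule.Quotient.mk_eq_zero M).mpr hl, ofAdd_zero, map_one]
  · rwa [key]

/-- A subgroup of a finite abelian group is cut out by the characters trivial on it, and here all
`F*`-valued characters are Laurent monomials. -/
theorem mem_subgroup_of_forall_zmon_eq_one (H : Subgroup (ι → Fˣ)) {t : ι → Fˣ}
    (ht : ∀ u : ι → ℤ, (∀ h ∈ H, zmon h u = 1) → zmon t u = 1) : t ∈ H := by
  classical
  have : NeZero (Fintype.card F - 1) := ⟨(Nat.sub_pos_of_lt Fintype.one_lt_card).ne'⟩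
  have := hasEnoughRootsOfUnity_card_sub_one F
  have hex : HasEnoughRootsOfUnity F (Monoid.exponent (ι → Fˣ)) :=
    HasEnoughRootsOfUnity.of_dvd F (n := Fintype.card F - 1)
      (Monoid.exponent_dvd_of_forall_pow_eq_one fun x => funext fun i => units_pow_card_sub_one _)
  rw [← CommGroup.forall_monoidHom_apply_eq_one_iff F H]
  intro χ hχ
  obtain ⟨u, hu⟩ := exists_zmon_eq_of_isCyclic χ
  rw [hu]
  exact ht u fun h hh => (hu h).symm.trans (hχ h hh)

end FiniteField

/-! ### Lattice ideals and their vanishing on the torus -/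

section LatticeIdeal

variable (R : Type*) [CommRing R] {r : ℕ}

theorem monomial_sub_monomial_mem_latticeIdeal (L : Submodule ℤ (Fin r → ℤ)) (a b : Fin r →₀ ℕ)
    (h : (fun i => (a i : ℤ) - b i) ∈ L) :
    MvPolynomial.monomial a (1 : R) - MvPolynomial.monomial b 1 ∈ latticeIdeal R L := by
  -- With `m = a - b`, one has `a = a ⊓ b + m⁺` and `b = a ⊓ b + m⁻`.
  have h1 := Ideal.mul_mem_left (latticeIdeal R L) (MvPolynomial.monomial (a ⊓ b) 1)
    (Ideal.subset_span ⟨_, h, rfl⟩)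
  convert h1 using 1
  rw [mul_sub, MvPolynomial.monomial_mul, MvPolynomial.monomial_mul, one_mul]
  congr 2 <;>
  · congr 1
    ext i
    simp
    omega

variable {R}

theorem aeval_monomial_units {Ω : Type*} [Field Ω] [Algebra R Ω] (P : Fin r → Ωˣ)
    (a : Fin r →₀ ℕ) :
    MvPolynomial.aeval (fun i => (P i : Ω)) (MvPolynomial.monomial a (1 : R)) =
      (zmon P (fun i => (a i : ℤ)) : Ωˣ) := by
  rw [MvPolynomial.aeval_monomial, Finsupp.prod_fintype _ _ (by simp), zmon_eq_prod]
  simp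

theorem aeval_eq_zero_of_mem_latticeIdeal {Ω : Type*} [Field Ω] [Algebra R Ω]
    {L : Submodule ℤ (Fin r → ℤ)} {P : Fin r → Ωˣ} (hP : ∀ m ∈ L, zmon P m = 1)
    {f : MvPolynomial (Fin r) R} (hf : f ∈ latticeIdeal R L) :
    MvPolynomial.aeval (fun i => (P i : Ω)) f = 0 := by
  have hle : latticeIdeal R L ≤ RingHom.ker (MvPolynomial.aeval (R := R) (fun i => (P i : Ω))) := by
    refine Ideal.span_le.mpr ?_
    rintro _ ⟨m, hm, rfl⟩
    rw [SetLike.mem_coe, RingHom.mem_ker, map_sub, aeval_monomial_units, aeval_monomial_units,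
      sub_eq_zero, Units.val_inj, ← div_eq_one, ← zmon_sub]
    convert hP m hm using 2
    ext i
    simp
  exact hle hf

end LatticeIdeal

/-! ### Consequences of the fan axioms, and the torus inside `X` -/

namespace CompleteSimplicialFan

variable {n r : ℕ} (Δ : CompleteSimplicialFan n r)

theorem phi_apply (u : Fin n → ℤ) (i : Fin r) : Δ.phi u i = ∑ j, Δ.ray i j * u j := rfl

/-- If `u` pairs to zero with every ray, it pairs to zero with every cone; by completeness `u`
itself lies in a cone, so `⟨u, u⟩ = 0`. -/
theorem phi_injective : Function.Injective Δ.phi := by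
  rw [← LinearMap.ker_eq_bot, LinearMap.ker_eq_bot']
  intro u hu
  have hu' : ∀ i, ∑ j, (Δ.ray i j : ℝ) * u j = 0 := fun i => by
    have := congrFun hu i
    rw [phi_apply] at this
    exact_mod_cast this
  obtain ⟨σ, -, hσ⟩ := Δ.complete (fun j => (u j : ℝ))
  have key : ∀ x ∈ PointedCone.hull ℝ ((fun i j => (Δ.ray i j : ℝ)) '' (σ : Set (Fin r))),
      ∑ j, x j * u j = 0 := by
    intro x hx
    induction hx using Submodule.span_induction with
    | mem x hx =>
      obtain ⟨i, -, rfl⟩ := hx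
      exact hu' i
    | zero => simp
    | add x y _ _ hx hy => simp [add_mul, Finset.sum_add_distrib, hx, hy]
    | smul a x _ hx =>
      have : ∀ j, (a • x) j * u j = (a : ℝ) * (x j * u j) := fun j => mul_assoc _ _ _
      simp_rw [this, ← Finset.mul_sum, hx, mul_zero]
  have h0 := key _ hσ
  rw [Finset.sum_eq_zero_iff_of_nonneg fun j _ => mul_self_nonneg _] at h0
  funext j
  simpa using h0 j (Finset.mem_univ j)

/-- A section `s` of the projection to the free class group makes `id - s ∘ mkQ` a retraction onto
`L_β`, which is then inverted along `φ`. -/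
theorem exists_leftInverse_phi (hCl : Module.Free ℤ Δ.ClGroup) :
    ∃ ψ : (Fin r → ℤ) →ₗ[ℤ] (Fin n → ℤ), ∀ u, ψ (Δ.phi u) = u := by
  obtain ⟨s, hs⟩ := Δ.latticeBeta.mkQ.exists_rightInverse_of_surjective
    (LinearMap.range_eq_top.mpr Δ.latticeBeta.mkQ_surjective)
  have hmem : ∀ x, x - s (Δ.latticeBeta.mkQ x) ∈ LinearMap.range Δ.phi := fun x => by
    refine (Submodule.Quotient.mk_eq_zero Δ.latticeBeta).mp ?_
    change Δ.latticeBeta.mkQ _ = 0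
    rw [map_sub, ← LinearMap.comp_apply Δ.latticeBeta.mkQ s, hs, LinearMap.id_apply, sub_self]
  refine ⟨(LinearEquiv.ofInjective Δ.phi Δ.phi_injective).symm.toLinearMap ∘ₗ
    LinearMap.codRestrict _ (LinearMap.id - s ∘ₗ Δ.latticeBeta.mkQ) hmem, fun u => ?_⟩
  rw [LinearMap.comp_apply, LinearEquiv.coe_coe, LinearEquiv.symm_apply_eq]
  ext1
  have : Δ.latticeBeta.mkQ (Δ.phi u) = 0 :=
    (Submodule.Quotient.mk_eq_zero Δ.latticeBeta).mpr ⟨u, rfl⟩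
  simp [this]

theorem exists_phi_pos {σ : Finset (Fin r)} (hσ : σ ∈ Δ.cones) :
    ∃ u : Fin n → ℤ, ∀ i ∈ σ, 0 < Δ.phi u i := by
  have hR := (Δ.simplicial σ hσ).restrict_scalars' ℚ
  let c : (Fin n → ℚ) →ₗ[ℚ] (Fin n → ℝ) := (Algebra.linearMap ℚ ℝ).compLeft (Fin n)
  have hQ : LinearIndependent ℚ (fun i : σ => (fun j => (Δ.ray i j : ℚ) : Fin n → ℚ)) := by
    refine LinearIndependent.of_comp c ?_
    convert hR using 1
    ext i j
    simp [c]
  obtain ⟨g, hg⟩ := LinearMap.exists_leftInverse_of_injective _ (LinearMap.ker_eq_bot.mpr hQ)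
  let f : (Fin n → ℚ) →ₗ[ℚ] ℚ := Finsupp.linearCombination ℚ (fun _ : σ => (1 : ℚ)) ∘ₗ g
  have hf : ∀ i ∈ σ, f (fun j => (Δ.ray i j : ℚ)) = 1 := fun i hi => by
    have := LinearMap.congr_fun hg (Finsupp.single (⟨i, hi⟩ : σ) 1)
    simp only [LinearMap.comp_apply, Finsupp.linearCombination_single, one_smul,
      LinearMap.id_apply] at this
    simp [f, this]
  obtain ⟨⟨b, hb⟩, hbint⟩ := IsLocalization.exist_integer_multiples_of_finite (nonZeroDivisors ℤ)
    (fun j : Fin n => f (Pi.single j 1))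
  choose w hw using hbint
  have hb0 : b ≠ 0 := nonZeroDivisors.ne_zero hb
  -- The common denominator `b` may be negative; the extra factor `b` makes the value `b * b`.
  refine ⟨b • w, fun i hi => ?_⟩
  have hsum : ((∑ j, Δ.ray i j * w j : ℤ) : ℚ) = b := by
    have h1 := hf i hi
    rw [← Finset.univ_sum_single (fun j => (Δ.ray i j : ℚ)), map_sum] at h1
    have h2 : ∀ j, f (Pi.single j (Δ.ray i j : ℚ)) = Δ.ray i j * f (Pi.single j 1) := fun j => by
      rw [← smul_eq_mul, ← map_smul, ← Pi.single_smul, smul_eq_mul, mul_one]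
    simp_rw [h2] at h1
    have h3 : ∀ j, (w j : ℚ) = b * f (Pi.single j 1) := fun j => by
      simpa using hw j
    push_cast
    simp_rw [h3]
    calc ∑ j, (Δ.ray i j : ℚ) * (b * f (Pi.single j 1))
        = b * ∑ j, (Δ.ray i j : ℚ) * f (Pi.single j 1) := by
          rw [Finset.mul_sum]
          exact Finset.sum_congr rfl fun j _ => by ring
      _ = b := by rw [h1, mul_one]
  have hsum' : Δ.phi w i = b := by exact_mod_cast hsum
  rw [map_smul, Pi.smul_apply, hsum', smul_eq_mul]
  exact mul_self_pos.mpr hb0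

theorem weight_degVar (a : Fin r →₀ ℕ) :
    Finsupp.weight Δ.degVar a = Δ.latticeBeta.mkQ (fun i => (a i : ℤ)) := by
  conv_rhs => rw [← Finset.univ_sum_single (fun i => (a i : ℤ)), map_sum]
  rw [Finsupp.weight_apply, Finsupp.sum_fintype _ _ (by simp)]
  refine Finset.sum_congr rfl fun i _ => ?_
  rw [degVar, ← map_nsmul, ← Pi.single_smul]
  simp

theorem weight_degVar_eq_iff (a b : Fin r →₀ ℕ) :
    Finsupp.weight Δ.degVar a = Finsupp.weight Δ.degVar b ↔
      (fun i => (a i : ℤ) - b i) ∈ Δ.latticeBeta := by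
  rw [weight_degVar, weight_degVar, ← sub_eq_zero, ← map_sub]
  exact Submodule.Quotient.mk_eq_zero Δ.latticeBeta

variable {R : Type*} [CommRing R]

theorem isHomog_binomial {L : Submodule ℤ (Fin r → ℤ)} (hL : L ≤ Δ.latticeBeta) {m : Fin r → ℤ}
    (hm : m ∈ L) : Δ.IsHomog
      (MvPolynomial.monomial (Finsupp.equivFunOnFinite.symm fun i => (m i).toNat) (1 : R) -
        MvPolynomial.monomial (Finsupp.equivFunOnFinite.symm fun i => (-m i).toNat) 1) := by
  refine ⟨_, (MvPolynomial.isWeightedHomogeneous_monomial _ _ _ rfl).sub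
    (MvPolynomial.isWeightedHomogeneous_monomial _ _ _ ?_)⟩
  rw [eq_comm, weight_degVar_eq_iff]
  convert hL hm using 1
  ext i
  simp

variable {Ω : Type*} [Field Ω]

theorem torusPi_apply (P : Fin r → Ωˣ) (j : Fin n) :
    Δ.torusPi Ω P j = zmon P (Δ.phi (Pi.single j 1)) := by
  rw [zmon_eq_prod]
  change ∏ i, P i ^ Δ.ray i j = _
  simp [phi_apply, Pi.single_apply]

theorem torusPi_eq_monomialMap : Δ.torusPi Ω = monomialMap Δ.phi :=
  MonoidHom.ext fun P => funext fun j => Δ.torusPi_apply P j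

theorem zmon_torusPi (P : Fin r → Ωˣ) (u : Fin n → ℤ) :
    zmon (Δ.torusPi Ω P) u = zmon P (Δ.phi u) := by
  rw [torusPi_eq_monomialMap, zmon_monomialMap]

/-- The point of `X` with homogeneous coordinates `P ∈ (Ω*)ʳ`. -/
noncomputable def torusPoint (P : Fin r → Ωˣ) : Δ.Points Ω :=
  Quotient.mk'' ⟨fun i => (P i : Ω), Δ.coe_mem_stablePoints Ω P⟩

theorem torusInclusion_mk (P : Fin r → Ωˣ) :
    Δ.torusInclusion Ω (QuotientGroup.mk' (Δ.groupG Ω) P) = Δ.torusPoint P := rfl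

/-- `G` acts by units, so it keeps torus points in the torus, and `π` is constant on orbits because
`G = ker π`. -/
theorem exists_of_mk_eq_torusPoint {P : Fin r → Ωˣ} {Q : Δ.stablePoints Ω}
    (h : (Quotient.mk'' Q : Δ.Points Ω) = Δ.torusPoint P) :
    ∃ Q' : Fin r → Ωˣ, (Q : Fin r → Ω) = (fun i => (Q' i : Ω)) ∧
      Δ.torusPi Ω Q' = Δ.torusPi Ω P := by
  obtain ⟨g, hg⟩ := MulAction.orbitRel_apply.mp (Quotient.exact' h)
  refine ⟨(g : Fin r → Ωˣ) * P, ?_, ?_⟩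
  · rw [← hg]
    rfl
  · rw [map_mul, show Δ.torusPi Ω g = 1 from g.2, one_mul]

theorem torusPoint_eq_iff {P Q : Fin r → Ωˣ} :
    Δ.torusPoint P = Δ.torusPoint Q ↔ Δ.torusPi Ω P = Δ.torusPi Ω Q := by
  constructor
  · intro h
    obtain ⟨Q', h1, h2⟩ := Δ.exists_of_mk_eq_torusPoint h
    have : P = Q' := funext fun i => Units.ext (congrFun h1 i)
    rw [this, h2]
  · intro h
    rw [← torusInclusion_mk, ← torusInclusion_mk]
    congr 1
    refine QuotientGroup.eq.mpr ?_
    change Δ.torusPi Ω (P⁻¹ * Q) = 1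
    rw [map_mul, map_inv, h, inv_mul_cancel]

theorem torusInclusion_injective : Function.Injective (Δ.torusInclusion Ω) := by
  intro x y h
  obtain ⟨P, rfl⟩ := QuotientGroup.mk'_surjective _ x
  obtain ⟨Q, rfl⟩ := QuotientGroup.mk'_surjective _ y
  rw [torusInclusion_mk, torusInclusion_mk, torusPoint_eq_iff] at h
  refine QuotientGroup.eq.mpr ?_
  change Δ.torusPi Ω (P⁻¹ * Q) = 1
  rw [map_mul, map_inv, h, inv_mul_cancel]

/-- A stable point at which all the binomials of a lattice between a positive multiple of `L_β`
and `L_β` vanish lies in the torus. -/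
theorem ne_zero_of_binomials_vanish [Algebra R Ω] {k : ℕ} (hk : 0 < k)
    {L : Submodule ℤ (Fin r → ℤ)} (hL : ∀ m ∈ Δ.latticeBeta, (k : ℤ) • m ∈ L)
    (P : Δ.stablePoints Ω) (hP : ∀ m ∈ L, MvPolynomial.aeval (P : Fin r → Ω)
      (MvPolynomial.monomial (Finsupp.equivFunOnFinite.symm fun i => (m i).toNat) (1 : R) -
        MvPolynomial.monomial (Finsupp.equivFunOnFinite.symm fun i => (-m i).toNat) 1) = 0)
    (i : Fin r) : (P : Fin r → Ω) i ≠ 0 := by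
  intro hi
  have hst : (P : Fin r → Ω) ∉ MvPolynomial.zeroLocus Ω (Δ.irrelevantIdeal Ω) := P.2
  rw [irrelevantIdeal, MvPolynomial.zeroLocus_span] at hst
  simp only [Set.mem_ofPred_eq, not_forall] at hst
  obtain ⟨_, ⟨σ, hσ, rfl⟩, hne⟩ := hst
  rw [map_prod, Finset.prod_eq_zero_iff] at hne
  simp only [MvPolynomial.aeval_X, not_exists, not_and, Finset.mem_compl] at hne
  -- Coordinates outside `σ` are nonzero, so `i ∈ σ`. In the binomial of `k • φ(u)` the positive
  -- monomial contains `x_i` and vanishes, while the negative one involves only variables outside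
  -- `σ` and does not.
  obtain ⟨u, hu⟩ := Δ.exists_phi_pos hσ
  have hiσ : i ∈ σ := by
    by_contra h
    exact hne i h hi
  have h := hP _ (hL _ ⟨u, rfl⟩)
  rw [map_sub, MvPolynomial.aeval_monomial, MvPolynomial.aeval_monomial, map_one, one_mul, one_mul,
    Finsupp.prod_fintype _ _ (by simp), Finsupp.prod_fintype _ _ (by simp), sub_eq_zero,
    Finset.prod_eq_zero (Finset.mem_univ i), eq_comm, Finset.prod_eq_zero_iff] at h
  · obtain ⟨j, -, hj⟩ := h
    by_cases hjσ : j ∈ σ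
    · have : (-((k : ℤ) • Δ.phi u) j).toNat = 0 := by
        have := mul_pos (Int.natCast_pos.mpr hk) (hu j hjσ)
        rw [Pi.smul_apply, smul_eq_mul]
        omega
      simp only [Finsupp.coe_equivFunOnFinite_symm] at hj
      rw [this, pow_zero] at hj
      exact one_ne_zero hj
    · exact hne j hjσ (eq_zero_of_pow_eq_zero hj)
  · rw [hi]
    refine zero_pow ?_
    have := mul_pos (Int.natCast_pos.mpr hk) (hu i hiσ)
    simp only [Finsupp.coe_equivFunOnFinite_symm, Pi.smul_apply, smul_eq_mul]
    omega

end CompleteSimplicialFan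

/-! ### Duality between intermediate lattices and subgroups of the torus -/

namespace CompleteSimplicialFan

variable {n r : ℕ} (Δ : CompleteSimplicialFan n r)
variable (F : Type*) [Field F]

/-- The subgroup of `(F*)ⁿ ≅ T_X(F)` on which all characters in the lattice `L` are trivial. -/
def latticeSubgroup (L : Submodule ℤ (Fin r → ℤ)) : Subgroup (Fin n → Fˣ) where
  carrier := {t | ∀ u, Δ.phi u ∈ L → zmon t u = 1}
  one_mem' _ _ := zmon_one_left _
  mul_mem' ha hb u hu := by rw [zmon_mul_left, ha u hu, hb u hu, one_mul]
  inv_mem' {t} ht u hu := by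
    rw [← zmonHom_apply, map_inv, zmonHom_apply, ht u hu, inv_one]

variable {F}

/-- The lattice of the characters that are trivial on a subgroup of `(F*)ⁿ ≅ T_X(F)`. -/
def subgroupLattice (H : Subgroup (Fin n → Fˣ)) : Submodule ℤ (Fin r → ℤ) :=
  Submodule.map Δ.phi
    { carrier := {u | ∀ t ∈ H, zmon t u = 1}
      zero_mem' := fun _ _ => zmon_zero _
      add_mem' := fun ha hb t ht => by rw [zmon_add, ha t ht, hb t ht, one_mul]
      smul_mem' := fun k u hu t ht => by rw [zmon_zsmul, hu t ht, one_zpow] }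

theorem phi_mem_subgroupLattice {H : Subgroup (Fin n → Fˣ)} {u : Fin n → ℤ} :
    Δ.phi u ∈ Δ.subgroupLattice H ↔ ∀ t ∈ H, zmon t u = 1 := by
  constructor
  · rintro ⟨u', hu', h⟩
    rw [← Δ.phi_injective h]
    exact hu'
  · exact fun h => ⟨u, h, rfl⟩

theorem subgroupLattice_le (H : Subgroup (Fin n → Fˣ)) : Δ.subgroupLattice H ≤ Δ.latticeBeta := by
  rintro _ ⟨u, -, rfl⟩
  exact ⟨u, rfl⟩

section Duality

variable [Fintype F]

theorem isIntermediate_subgroupLattice (H : Subgroup (Fin n → Fˣ)) :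
    Δ.IsIntermediate (Fintype.card F) (Δ.subgroupLattice H) := by
  refine ⟨?_, Δ.subgroupLattice_le H⟩
  rintro _ ⟨u, rfl⟩
  rw [← map_smul, phi_mem_subgroupLattice]
  intro t _
  rw [zmon_zsmul, zpow_card_sub_one]

theorem latticeSubgroup_subgroupLattice (H : Subgroup (Fin n → Fˣ)) :
    Δ.latticeSubgroup F (Δ.subgroupLattice H) = H := by
  refine le_antisymm (fun t ht => ?_) fun t ht u hu => Δ.phi_mem_subgroupLattice.mp hu t ht
  exact mem_subgroup_of_forall_zmon_eq_one H fun u hu =>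
    ht u (Δ.phi_mem_subgroupLattice.mpr hu)

theorem subgroupLattice_latticeSubgroup {L : Submodule ℤ (Fin r → ℤ)}
    (hL : Δ.IsIntermediate (Fintype.card F) L) :
    Δ.subgroupLattice (Δ.latticeSubgroup F L) = L := by
  refine le_antisymm ?_ fun m hm => ?_
  · rintro _ ⟨u, hu, rfl⟩
    by_contra h
    -- Pulled back along `φ`, the condition `(q - 1) L_β ⊆ L` says that `L` contains `(q - 1) ℤⁿ`,
    -- so a character outside it is detected by an `F`-point.
    obtain ⟨t, ht, hne⟩ := exists_zmon_ne_one_of_notMem_submodule (F := F) (L.comap Δ.phi)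
      (fun u => by
        rw [Submodule.mem_comap, map_smul]
        exact hL.1 _ ⟨u, rfl⟩) (m := u) h
    exact hne (hu t fun u' hu' => ht u' hu')
  · obtain ⟨u, rfl⟩ := hL.2 hm
    exact Δ.phi_mem_subgroupLattice.mpr fun t ht => ht u hm

end Duality

/-! ### Points and ideals attached to subgroups of the torus -/

section TorusParam

variable {Ω : Type*} [Field Ω] [Algebra F Ω] {ψ : (Fin r → ℤ) →ₗ[ℤ] (Fin n → ℤ)}

/-- `ψ` gives a section of `π`: on characters the composite is `ψ ∘ φ = id`. -/
theorem torusPi_monomialMap (hψ : ∀ u, ψ (Δ.phi u) = u) {k : Type*} [Field k] (s : Fin n → kˣ) :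
    Δ.torusPi k (monomialMap ψ s) = s := by
  funext j
  rw [torusPi_apply, zmon_monomialMap, hψ, zmon_single]

/-- The map on tori `(F*)ᵐ → (Ω*)ᵐ` induced by a field extension `Ω / F`. -/
def unitsBaseChange (F Ω : Type*) [Field F] [Field Ω] [Algebra F Ω] (m : ℕ) :
    (Fin m → Fˣ) →* (Fin m → Ωˣ) :=
  MonoidHom.compLeft (Units.map (algebraMap F Ω : F →* Ω)) (Fin m)

theorem zmon_unitsBaseChange {m : ℕ} (t : Fin m → Fˣ) (u : Fin m → ℤ) :
    zmon (unitsBaseChange F Ω m t) u = Units.map (algebraMap F Ω : F →* Ω) (zmon t u) :=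
  (map_zmon (Units.map (algebraMap F Ω : F →* Ω)) t u).symm

theorem zmon_unitsBaseChange_eq_one_iff {m : ℕ} (t : Fin m → Fˣ) (u : Fin m → ℤ) :
    zmon (unitsBaseChange F Ω m t) u = 1 ↔ zmon t u = 1 := by
  rw [zmon_unitsBaseChange]
  exact map_eq_one_iff _ (Units.map_injective (algebraMap F Ω).injective)

theorem unitsBaseChange_monomialMap (t : Fin n → Fˣ) :
    unitsBaseChange F Ω r (monomialMap ψ t) = monomialMap ψ (unitsBaseChange F Ω n t) :=
  funext fun i => map_monomialMap (Units.map (algebraMap F Ω : F →* Ω)) ψ t i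

theorem torusPi_unitsBaseChange (P : Fin r → Fˣ) :
    Δ.torusPi Ω (unitsBaseChange F Ω r P) = unitsBaseChange F Ω n (Δ.torusPi F P) := by
  rw [torusPi_eq_monomialMap, torusPi_eq_monomialMap]
  exact (funext fun i => map_monomialMap (Units.map (algebraMap F Ω : F →* Ω)) Δ.phi P i).symm

variable (Ω ψ) in
/-- The parametrization `(F*)ⁿ → T_X` of the `F`-rational points of the torus defined by a left
inverse `ψ` of `φ`. -/
noncomputable def torusParam : (Fin n → Fˣ) →* Δ.Torus Ω :=
  (QuotientGroup.mk' (Δ.groupG Ω)).comp ((monomialMap ψ).comp (unitsBaseChange F Ω n))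

variable (Ω ψ) in
/-- The points of `X` corresponding to a subgroup of `(F*)ⁿ ≅ T_X(F)`. -/
def subgroupPoints (H : Subgroup (Fin n → Fˣ)) : Set (Δ.Points Ω) :=
  {x | ∃ t ∈ H, x = Δ.torusPoint (monomialMap ψ (unitsBaseChange F Ω n t))}

theorem image_map_torusParam (H : Subgroup (Fin n → Fˣ)) :
    Δ.torusInclusion Ω '' (H.map (Δ.torusParam Ω ψ) : Set (Δ.Torus Ω)) =
      Δ.subgroupPoints Ω ψ H := by
  ext x
  simp only [Subgroup.coe_map, Set.mem_image, SetLike.mem_coe, exists_exists_and_eq_and]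
  exact exists_congr fun t => and_congr_right fun _ => eq_comm

theorem range_torusParam (hψ : ∀ u, ψ (Δ.phi u) = u) :
    (Δ.torusParam (F := F) Ω ψ).range = Δ.torusRational Ω F := by
  ext x
  constructor
  · rintro ⟨t, rfl⟩
    refine ⟨unitsBaseChange F Ω r (monomialMap ψ t), ⟨_, rfl⟩, ?_⟩
    rw [unitsBaseChange_monomialMap]
    rfl
  · rintro ⟨_, ⟨P, rfl⟩, rfl⟩
    refine ⟨Δ.torusPi F P, Δ.torusInclusion_injective ?_⟩
    rw [torusInclusion_mk]
    refine Δ.torusPoint_eq_iff.mpr ?_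
    rw [MonoidHom.comp_apply, torusPi_monomialMap Δ hψ, ← torusPi_unitsBaseChange]
    rfl

theorem exists_image_torusInclusion_iff (hψ : ∀ u, ψ (Δ.phi u) = u) (Y : Set (Δ.Points Ω)) :
    (∃ H : Subgroup (Δ.Torus Ω),
      H ≤ Δ.torusRational Ω F ∧ Y = Δ.torusInclusion Ω '' (H : Set (Δ.Torus Ω))) ↔
    ∃ H : Subgroup (Fin n → Fˣ), Y = Δ.subgroupPoints Ω ψ H := by
  constructor
  · rintro ⟨H, hH, rfl⟩
    refine ⟨H.comap (Δ.torusParam Ω ψ), ?_⟩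
    rw [← image_map_torusParam, Subgroup.map_comap_eq_self]
    rwa [range_torusParam Δ hψ]
  · rintro ⟨H, rfl⟩
    refine ⟨H.map (Δ.torusParam Ω ψ), ?_, (Δ.image_map_torusParam H).symm⟩
    rw [← range_torusParam Δ hψ]
    exact Subgroup.map_le_range _ _

theorem mem_rationalPoints_of_mem_subgroupPoints (k : Type*) [Field k] [Algebra F k] [Algebra k Ω]
    [IsScalarTower F k Ω] {H : Subgroup (Fin n → Fˣ)} {x : Δ.Points Ω}
    (hx : x ∈ Δ.subgroupPoints Ω ψ H) : x ∈ Δ.rationalPoints Ω k := by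
  obtain ⟨t, -, rfl⟩ := hx
  rw [← unitsBaseChange_monomialMap]
  have h : (fun i => algebraMap k Ω (algebraMap F k (monomialMap ψ t i : Fˣ))) =
      fun i => (unitsBaseChange F Ω r (monomialMap ψ t) i : Ω) :=
    funext fun i => (IsScalarTower.algebraMap_apply F k Ω _).symm
  refine ⟨fun i => algebraMap F k (monomialMap ψ t i : Fˣ), ?_, ?_⟩
  · rw [h]
    exact Δ.coe_mem_stablePoints Ω _
  · exact congrArg Quotient.mk'' (Subtype.ext h.symm)

/-- The elements of the lattice ideal vanish at every representative of a point of the torus on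
which the characters of the lattice are trivial. -/
theorem vanishesAt_of_mem_latticeIdeal (hψ : ∀ u, ψ (Δ.phi u) = u) {R : Type*} [CommRing R]
    [Algebra R Ω] {L : Submodule ℤ (Fin r → ℤ)} (hL : L ≤ Δ.latticeBeta) {t : Fin n → Fˣ}
    (ht : t ∈ Δ.latticeSubgroup F L) {f : MvPolynomial (Fin r) R} (hf : f ∈ latticeIdeal R L) :
    Δ.VanishesAt f (Δ.torusPoint (monomialMap ψ (unitsBaseChange F Ω n t))) := by
  intro P hP
  obtain ⟨Q, hQ, hpi⟩ := Δ.exists_of_mk_eq_torusPoint hP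
  rw [torusPi_monomialMap Δ hψ] at hpi
  rw [hQ]
  refine aeval_eq_zero_of_mem_latticeIdeal (fun m hm => ?_) hf
  obtain ⟨u, rfl⟩ := hL hm
  rw [← zmon_torusPi, hpi, zmon_unitsBaseChange_eq_one_iff]
  exact ht u hm

/-- The right-hand side involves neither `k` nor `R`, which is why the zero set has only
`F`-rational points and does not depend on the coefficient ring. -/
theorem zeroSet_latticeIdeal [Fintype F] (hψ : ∀ u, ψ (Δ.phi u) = u) (k : Type*) [Field k]
    [Algebra F k] [Algebra k Ω] [IsScalarTower F k Ω] (R : Type*) [CommRing R] [Algebra R Ω]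
    {L : Submodule ℤ (Fin r → ℤ)} (hL : Δ.IsIntermediate (Fintype.card F) L) :
    Δ.zeroSet Ω k (latticeIdeal R L) = Δ.subgroupPoints Ω ψ (Δ.latticeSubgroup F L) := by
  ext x
  constructor
  · rintro ⟨⟨P, hP, rfl⟩, hx⟩
    have hvan := fun m (hm : m ∈ L) =>
      hx _ (Ideal.subset_span ⟨m, hm, rfl⟩) (Δ.isHomog_binomial hL.2 hm) ⟨_, hP⟩ rfl
    have hq : 0 < Fintype.card F - 1 := Nat.sub_pos_of_lt Fintype.one_lt_card
    have hcast : ((Fintype.card F - 1 : ℕ) : ℤ) = (Fintype.card F : ℤ) - 1 := by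
      rw [Nat.cast_sub Fintype.card_pos, Nat.cast_one]
    have hne := Δ.ne_zero_of_binomials_vanish hq (by rw [hcast]; exact hL.1) ⟨_, hP⟩ hvan
    obtain ⟨Q, hQ⟩ : ∃ Q : Fin r → Ωˣ, (fun i => algebraMap k Ω (P i)) = fun i => (Q i : Ω) :=
      ⟨fun i => Units.mk0 _ (hne i), rfl⟩
    have hone : ∀ m ∈ L, zmon Q m = 1 := fun m hm => by
      have h := hvan m hm
      change MvPolynomial.aeval (fun i => algebraMap k Ω (P i)) _ = 0 at h
      rw [hQ, map_sub, aeval_monomial_units, aeval_monomial_units, sub_eq_zero, Units.val_inj,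
        ← div_eq_one, ← zmon_sub] at h
      convert h using 2
      ext i
      simp
    -- The coordinates of `Q` need not lie in `F`, but those of `π(Q)` do: `(q - 1) L_β ⊆ L` makes
    -- them `(q - 1)`-th roots of unity.
    have hroot : ∀ j, Δ.torusPi Ω Q j ^ ((Fintype.card F : ℤ) - 1) = 1 := fun j => by
      rw [torusPi_apply, ← zmon_zsmul]
      exact hone _ (hL.1 _ ⟨_, rfl⟩)
    choose t ht using fun j => exists_units_map_eq (F := F) _ (hroot j)
    have ht' : unitsBaseChange F Ω n t = Δ.torusPi Ω Q := funext ht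
    refine ⟨t, fun u hu => ?_, ?_⟩
    · rw [← zmon_unitsBaseChange_eq_one_iff (Ω := Ω), ht', zmon_torusPi]
      exact hone _ hu
    · have hpt : (Quotient.mk'' ⟨_, hP⟩ : Δ.Points Ω) = Δ.torusPoint Q :=
        congrArg Quotient.mk'' (Subtype.ext hQ)
      rw [hpt, torusPoint_eq_iff, torusPi_monomialMap Δ hψ, ht']
  · intro hx
    refine ⟨Δ.mem_rationalPoints_of_mem_subgroupPoints k hx, fun f hf _ => ?_⟩
    obtain ⟨t, ht, rfl⟩ := hx
    exact Δ.vanishesAt_of_mem_latticeIdeal hψ hL.2 ht hf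

/-- Each monomial of `f` restricts to a character of `H`. Two monomials of equal degree with the
same character differ by an element of the ideal, and by Dedekind the coefficients belonging to each
character sum to zero. -/
theorem mem_latticeIdeal_of_vanishes (hψ : ∀ u, ψ (Δ.phi u) = u) {R : Type*} [Field R]
    [Algebra R Ω] (H : Subgroup (Fin n → Fˣ)) {f : MvPolynomial (Fin r) R} (hf : Δ.IsHomog f)
    (hvan : ∀ t ∈ H, MvPolynomial.aeval
      (fun i => ((monomialMap ψ (unitsBaseChange F Ω n t) i : Ωˣ) : Ω)) f = 0) :
    f ∈ latticeIdeal R (Δ.subgroupLattice H) := by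
  classical
  obtain ⟨α, hα⟩ := hf
  let char : (Fin r →₀ ℕ) → (H →* Ω) := fun a =>
    (Units.coeHom Ω).comp (((zmonHom (ψ fun i => (a i : ℤ))).comp (unitsBaseChange F Ω n)).comp
      H.subtype)
  have hchar : ∀ a ∈ f.support, ∀ b ∈ f.support, char a = char b →
      MvPolynomial.monomial a (1 : R) - MvPolynomial.monomial b 1 ∈
        latticeIdeal R (Δ.subgroupLattice H) := by
    intro a ha b hb hab
    refine monomial_sub_monomial_mem_latticeIdeal R _ a b ?_
    obtain ⟨u, hu⟩ := (Δ.weight_degVar_eq_iff a b).mp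
      ((hα (MvPolynomial.mem_support_iff.mp ha)).trans
        (hα (MvPolynomial.mem_support_iff.mp hb)).symm)
    rw [← hu, phi_mem_subgroupLattice]
    intro t ht
    have h : zmon (unitsBaseChange F Ω n t) (ψ fun i => (a i : ℤ)) =
        zmon (unitsBaseChange F Ω n t) (ψ fun i => (b i : ℤ)) :=
      Units.ext (DFunLike.congr_fun hab (⟨t, ht⟩ : H))
    -- Homogeneity gives `a - b = φ(u)`, and applying `ψ` gives `u = ψ(a) - ψ(b)`.
    rw [← zmon_unitsBaseChange_eq_one_iff (Ω := Ω), ← hψ u, hu,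
      show (fun i => (a i : ℤ) - b i) = (fun i => (a i : ℤ)) - fun i => (b i : ℤ) from rfl,
      map_sub, zmon_sub, h, div_self']
  have hcomb : ∑ a ∈ f.support, Finsupp.single (char a) (f.coeff a) = 0 := by
    refine (linearIndependent_iff.mp
      ((linearIndependent_monoidHom H Ω).restrict_scalars' R)) _ ?_
    rw [map_sum]
    funext t
    have h := hvan t t.2
    rw [MvPolynomial.aeval_def, MvPolynomial.eval₂_eq'] at h
    rw [Finset.sum_apply, Pi.zero_apply, ← h]
    refine Finset.sum_congr rfl fun a _ => ?_
    rw [Finsupp.linearCombination_single, Pi.smul_apply, Algebra.smul_def]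
    congr 1
    change ((zmon (unitsBaseChange F Ω n t) (ψ fun i => (a i : ℤ)) : Ωˣ) : Ω) = _
    rw [← zmon_monomialMap, zmon_eq_prod]
    simp
  let I := latticeIdeal R (Δ.subgroupLattice H)
  -- `g` sends a character to the common class of the monomials inducing it; the value `0` at other
  -- characters plays no role. Extended linearly, it turns the relation `hcomb` into `f ≡ 0` modulo
  -- `I`.
  let g : (H →* Ω) → MvPolynomial (Fin r) R ⧸ I := fun χ =>
    if h : ∃ a ∈ f.support, char a = χ then
      Ideal.Quotient.mk I (MvPolynomial.monomial h.choose 1) else 0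
  have hg : ∀ a ∈ f.support, g (char a) = Ideal.Quotient.mk I (MvPolynomial.monomial a 1) := by
    intro a ha
    have h : ∃ b ∈ f.support, char b = char a := ⟨a, ha, rfl⟩
    simp only [g, dif_pos h]
    exact Ideal.Quotient.eq.mpr (hchar _ h.choose_spec.1 _ ha h.choose_spec.2)
  have h0 := congrArg (Finsupp.linearCombination R g) hcomb
  rw [map_sum, map_zero] at h0
  refine Ideal.Quotient.eq_zero_iff_mem.mp ?_
  rw [← h0]
  conv_lhs => rw [f.as_sum, map_sum]
  refine Finset.sum_congr rfl fun a ha => ?_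
  rw [Finsupp.linearCombination_single, hg a ha, ← mul_one (f.coeff a), ← smul_eq_mul,
    ← MvPolynomial.smul_monomial, smul_eq_mul, mul_one]
  rfl

theorem idealOf_subgroupPoints (hψ : ∀ u, ψ (Δ.phi u) = u) (R : Type*) [Field R]
    [Algebra R Ω] (H : Subgroup (Fin n → Fˣ)) :
    Δ.idealOf R (Δ.subgroupPoints Ω ψ H) = latticeIdeal R (Δ.subgroupLattice H) := by
  refine le_antisymm (Ideal.span_le.mpr ?_) (Ideal.span_le.mpr ?_)
  · rintro f ⟨hf, hvan⟩
    exact Δ.mem_latticeIdeal_of_vanishes hψ H hf fun t ht =>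
      hvan _ ⟨t, ht, rfl⟩ ⟨_, Δ.coe_mem_stablePoints Ω _⟩ rfl
  · rintro _ ⟨m, hm, rfl⟩
    refine Ideal.subset_span ⟨Δ.isHomog_binomial (Δ.subgroupLattice_le H) hm, ?_⟩
    rintro _ ⟨t, ht, rfl⟩
    exact Δ.vanishesAt_of_mem_latticeIdeal hψ (Δ.subgroupLattice_le H)
      (fun u hu => Δ.phi_mem_subgroupLattice.mp hu t ht) (Ideal.subset_span ⟨m, hm, rfl⟩)

theorem idealOf_zeroSet_latticeIdeal [Fintype F] (hψ : ∀ u, ψ (Δ.phi u) = u) (k : Type*) [Field k]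
    [Algebra F k] [Algebra k Ω] [IsScalarTower F k Ω] (R : Type*) [Field R] [Algebra R Ω]
    {L : Submodule ℤ (Fin r → ℤ)} (hL : Δ.IsIntermediate (Fintype.card F) L) :
    Δ.idealOf R (Δ.zeroSet Ω k (latticeIdeal R L)) = latticeIdeal R L := by
  rw [Δ.zeroSet_latticeIdeal hψ k R hL, Δ.idealOf_subgroupPoints hψ,
    Δ.subgroupLattice_latticeSubgroup hL]

end TorusParam

end CompleteSimplicialFan

theorem theoremt {n r : ℕ} (Δ : CompleteSimplicialFan n r) (hCl : Module.Free ℤ Δ.ClGroup)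
    (F K Ω : Type*) [Field F] [Fintype F] [Field K] [Field Ω] [Algebra F K] [Algebra K Ω]
    [Algebra F Ω] [IsScalarTower F K Ω] [IsAlgClosure K Ω] :
    (∀ L : Submodule ℤ (Fin r → ℤ), Δ.IsIntermediate (Fintype.card F) L →
      Δ.idealOf F (Δ.zeroSet Ω K (latticeIdeal F L)) = latticeIdeal F L ∧
      Δ.idealOf K (Δ.zeroSet Ω K (latticeIdeal K L)) = latticeIdeal K L ∧
      Δ.zeroSet Ω K (latticeIdeal F L) = Δ.zeroSet Ω F (latticeIdeal F L) ∧
      Δ.zeroSet Ω K (latticeIdeal K L) = Δ.zeroSet Ω F (latticeIdeal F L)) ∧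
    Set.BijOn (fun J : Ideal (MvPolynomial (Fin r) F) => Δ.zeroSet Ω F J)
      {J | ∃ L : Submodule ℤ (Fin r → ℤ),
        Δ.IsIntermediate (Fintype.card F) L ∧ J = latticeIdeal F L}
      {Y | ∃ H : Subgroup (Δ.Torus Ω),
        H ≤ Δ.torusRational Ω F ∧ Y = Δ.torusInclusion Ω '' (H : Set (Δ.Torus Ω))} ∧
    Set.InvOn (fun Y : Set (Δ.Points Ω) => Δ.idealOf F Y)
      (fun J : Ideal (MvPolynomial (Fin r) F) => Δ.zeroSet Ω F J)
      {J | ∃ L : Submodule ℤ (Fin r → ℤ),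
        Δ.IsIntermediate (Fintype.card F) L ∧ J = latticeIdeal F L}
      {Y | ∃ H : Subgroup (Δ.Torus Ω),
        H ≤ Δ.torusRational Ω F ∧ Y = Δ.torusInclusion Ω '' (H : Set (Δ.Torus Ω))} := by
  obtain ⟨ψ, hψ⟩ := Δ.exists_leftInverse_phi hCl
  have hinv : Set.InvOn (fun Y : Set (Δ.Points Ω) => Δ.idealOf F Y)
      (fun J : Ideal (MvPolynomial (Fin r) F) => Δ.zeroSet Ω F J)
      {J | ∃ L : Submodule ℤ (Fin r → ℤ),
        Δ.IsIntermediate (Fintype.card F) L ∧ J = latticeIdeal F L}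
      {Y | ∃ H : Subgroup (Δ.Torus Ω),
        H ≤ Δ.torusRational Ω F ∧ Y = Δ.torusInclusion Ω '' (H : Set (Δ.Torus Ω))} := by
    constructor
    · rintro _ ⟨L, hL, rfl⟩
      exact Δ.idealOf_zeroSet_latticeIdeal hψ F F hL
    · intro Y hY
      obtain ⟨H, rfl⟩ := (Δ.exists_image_torusInclusion_iff hψ Y).mp hY
      beta_reduce
      rw [Δ.idealOf_subgroupPoints hψ, Δ.zeroSet_latticeIdeal hψ F F
        (Δ.isIntermediate_subgroupLattice H), Δ.latticeSubgroup_subgroupLattice]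
  refine ⟨fun L hL => ⟨Δ.idealOf_zeroSet_latticeIdeal hψ K F hL,
    Δ.idealOf_zeroSet_latticeIdeal hψ K K hL, ?_, ?_⟩, hinv.bijOn ?_ ?_, hinv⟩
  · rw [Δ.zeroSet_latticeIdeal hψ K F hL, Δ.zeroSet_latticeIdeal hψ F F hL]
  · rw [Δ.zeroSet_latticeIdeal hψ K K hL, Δ.zeroSet_latticeIdeal hψ F F hL]
  · rintro _ ⟨L, hL, rfl⟩
    exact (Δ.exists_image_torusInclusion_iff hψ _).mpr
      ⟨_, Δ.zeroSet_latticeIdeal hψ F F hL⟩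
  · intro Y hY
    obtain ⟨H, rfl⟩ := (Δ.exists_image_torusInclusion_iff hψ Y).mp hY
    exact ⟨_, Δ.isIntermediate_subgroupLattice H, Δ.idealOf_subgroupPoints hψ F H⟩
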